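/- Let $\mathbb{R}^-=(-\infty,0]$ and let $w\in C^1(\mathbb{R}^-;\mathbb{R})$ be a weight with $w>0$ and $w'/w$ bounded. Put $L^2_w=L^2(\mathbb{R}^-,w(\xi)\,d\xi;\mathbb{R})$ and let $H_w=\mathbb{R}\times L^2_w$ be the product Hilbert space, with elements $\mathbf{x}=(x_0,x_1)$. A function $f\in L^2_{loc}(\mathbb{R}^-)$ has weak derivative $f'=g\in L^2_{loc}(\mathbb{R}^-)$ if $\int_{\mathbb{R}^-} f\varphi'\,d\xi=-\int_{\mathbb{R}^-} g\varphi\,d\xi$ for all $\varphi\in C^1_c((-\infty,0);\mathbb{R})$; such an $f$ has a locally absolutely continuous version on $\mathbb{R}^-$, and $f(0)$ denotes the value of that version at $0$. Let $W^{1,2}_w$ be the set of such $f$ with $\int_{\mathbb{R}^-}(|f|^2+|f'|^2)\,w\,d\xi<\infty$. For every $t\ge 0$ the formula $$T(t)\mathbf{x}=\Big(x_0,\ x_0\mathbf{1}_{(0,t]}(t+\cdot)+x_1(t+\cdot)\mathbf{1}_{\mathbb{R}^-}(t+\cdot)\Big)$$ defines a bounded linear operator on $H_w$, and the family $(T(t))_{t\ge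 0}$ is a strongly continuous semigroup on $H_w$. Its generator is the closed unbounded operator $\mathcal{A}$ with domain $$D(\mathcal{A})=\{\mathbf{x}=(x_0,x_1)\in H_w \mid x_1\in W^{1,2}_w,\ x_0=x_1(0)\},\qquad \mathcal{A}\mathbf{x}=(0,x_1').$$ -/

import Mathlib

open MeasureTheory Set Filter Topology
open scoped NNReal ENNReal

namespace DelayShift

/-! ### Strongly continuous semigroups and their generators -/

/-- A strongly continuous semigroup of bounded linear operators `(T t)_{t ≥ 0}`. -/
structure IsC0Semigroup {E : Type*} [NormedAddCommGroup E] [NormedSpace ℝ E]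
    (T : ℝ≥0 → E →L[ℝ] E) : Prop where
  map_zero : T 0 = ContinuousLinearMap.id ℝ E
  map_add : ∀ s t : ℝ≥0, T (s + t) = (T s).comp (T t)
  continuous_orbit : ∀ x : E, Continuous fun t : ℝ≥0 => T t x

/-- `A` is the (infinitesimal) generator of `T`: its domain consists of exactly those `x` for which
the right derivative at `0` of the orbit `t ↦ T t x` exists, and `A x` is that derivative. -/
structure IsGenerator {E : Type*} [NormedAddCommGroup E] [NormedSpace ℝ E]
    (T : ℝ≥0 → E →L[ℝ] E) (A : E →ₗ.[ℝ] E) : Prop where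
  mem_domain_iff : ∀ x : E, x ∈ A.domain ↔
    ∃ y : E, Tendsto (fun t : ℝ≥0 => (t : ℝ)⁻¹ • (T t x - x)) (𝓝[>] 0) (𝓝 y)
  tendsto : ∀ x : A.domain,
    Tendsto (fun t : ℝ≥0 => (t : ℝ)⁻¹ • (T t (x : E) - (x : E))) (𝓝[>] 0) (𝓝 (A x))

/-! ### The weight and the weighted spaces on `ℝ⁻ = (-∞, 0]` -/

/-- `w ∈ C¹(ℝ⁻)`, `w > 0` and `w' / w` is bounded on `ℝ⁻`; values outside `ℝ⁻` play no role. -/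
structure IsWeight (w : ℝ → ℝ) : Prop where
  contDiffOn : ContDiffOn ℝ 1 w (Iic 0)
  pos : ∀ ξ ∈ Iic (0 : ℝ), 0 < w ξ
  bounded : ∃ K : ℝ, ∀ ξ ∈ Iic (0 : ℝ), |derivWithin w (Iic 0) ξ / w ξ| ≤ K

/-- The measure `w(ξ) dξ` on `ℝ⁻`. -/
noncomputable def weightMeasure (w : ℝ → ℝ) : Measure ℝ :=
  (volume.restrict (Iic 0)).withDensity fun ξ => ENNReal.ofReal (w ξ)

/-- `L²_w = L²(ℝ⁻, w(ξ) dξ; ℝ)`. -/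
abbrev L2w (w : ℝ → ℝ) : Type := Lp ℝ 2 (weightMeasure w)

/-- The Hilbert space `H_w = ℝ × L²_w`, with the Hilbertian product norm. -/
abbrev Hw (w : ℝ → ℝ) : Type := WithLp 2 (ℝ × L2w w)

/-- `f ∈ L²_loc(ℝ⁻)`: square integrable on every compact subinterval `[a, 0]` of `ℝ⁻`. -/
def MemL2loc (f : ℝ → ℝ) : Prop :=
  ∀ a : ℝ, MemLp f 2 (volume.restrict (Icc a 0))

/-- `g` is a weak derivative of `f` on `(-∞, 0)`, both functions being in `L²_loc(ℝ⁻)`. -/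
structure HasWeakDeriv (f g : ℝ → ℝ) : Prop where
  left : MemL2loc f
  right : MemL2loc g
  integral_eq : ∀ φ : ℝ → ℝ, ContDiff ℝ 1 φ → HasCompactSupport φ → tsupport φ ⊆ Iio 0 →
    ∫ ξ in Iic 0, f ξ * deriv φ ξ = -∫ ξ in Iic 0, g ξ * φ ξ

/-- `f ∈ W^{1,2}_w`: `f` has a weak derivative, and both lie in `L²_w`. -/
def MemW12 (w f : ℝ → ℝ) : Prop :=
  MemLp f 2 (weightMeasure w) ∧ ∃ g, HasWeakDeriv f g ∧ MemLp g 2 (weightMeasure w)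

/-- `f(0) = c`, read on the locally absolutely continuous version of `f` on `ℝ⁻`. -/
def HasValueAtZero (f : ℝ → ℝ) (c : ℝ) : Prop :=
  ∃ F : ℝ → ℝ, (∀ a ≤ 0, AbsolutelyContinuousOnInterval F a 0) ∧
    f =ᵐ[volume.restrict (Iic 0)] F ∧ F 0 = c

/-! ### The shift operators -/

/-- The function `ξ ↦ x₀ 1_{(0,t]}(t+ξ) + x₁(t+ξ) 1_{ℝ⁻}(t+ξ)`. -/
noncomputable def shiftFun (t : ℝ≥0) (x₀ : ℝ) (x₁ : ℝ → ℝ) (ξ : ℝ) : ℝ :=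
  x₀ * (Ioc (0 : ℝ) t).indicator 1 (t + ξ) + x₁ (t + ξ) * (Iic (0 : ℝ)).indicator 1 (t + ξ)

/-- The bounded operators `T t` on `H_w` act by
`T t x = (x₀, x₀ 1_{(0,t]}(t+·) + x₁(t+·) 1_{ℝ⁻}(t+·))`. -/
def IsShiftFamily (w : ℝ → ℝ) (T : ℝ≥0 → Hw w →L[ℝ] Hw w) : Prop :=
  ∀ (t : ℝ≥0) (x : Hw w), (T t x).fst = x.fst ∧
    (T t x).snd =ᵐ[weightMeasure w] shiftFun t x.fst x.snd

/-! ### Facts needed to define the operator `𝒜` -/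

theorem weightMeasure_ac (w : ℝ → ℝ) : weightMeasure w ≪ volume.restrict (Iic 0) :=
  withDensity_absolutelyContinuous _ _

theorem IsWeight.ac {w : ℝ → ℝ} (hw : IsWeight w) :
    volume.restrict (Iic 0) ≪ weightMeasure w := by
  refine withDensity_absolutelyContinuous' ?_ ?_
  · exact (hw.contDiffOn.continuousOn.aemeasurable measurableSet_Iic).ennreal_ofReal
  · filter_upwards [ae_restrict_mem measurableSet_Iic] with ξ hξ
    simpa using hw.pos ξ hξ

theorem IsWeight.ae_eq {w : ℝ → ℝ} (hw : IsWeight w) {f g : ℝ → ℝ}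
    (h : f =ᵐ[weightMeasure w] g) : f =ᵐ[volume.restrict (Iic 0)] g :=
  hw.ac.ae_le h

theorem MemL2loc.congr {f g : ℝ → ℝ} (hf : MemL2loc f)
    (h : f =ᵐ[volume.restrict (Iic 0)] g) : MemL2loc g := fun a =>
  (hf a).ae_eq (ae_restrict_of_ae_restrict_of_subset Icc_subset_Iic_self h)

theorem MemL2loc.locallyIntegrable {f : ℝ → ℝ} (hf : MemL2loc f) :
    LocallyIntegrable ((Iic (0 : ℝ)).indicator f) := by
  rw [locallyIntegrable_iff]
  intro k hk
  obtain ⟨a, ha⟩ := hk.bddBelow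
  rw [integrableOn_indicator_iff measurableSet_Iic]
  have h1 : IntegrableOn f (Icc a 0) := (hf a).integrable (by norm_num)
  exact h1.mono_set fun x hx => ⟨ha hx.2, hx.1⟩

theorem MemL2loc.integrable_mul {f ψ : ℝ → ℝ} (hf : MemL2loc f) (hψ : Continuous ψ)
    (hc : HasCompactSupport ψ) : IntegrableOn (fun ξ => f ξ * ψ ξ) (Iic 0) := by
  have h := hf.locallyIntegrable.integrable_smul_right_of_hasCompactSupport hψ hc
  refine (integrable_indicator_iff measurableSet_Iic).1 (h.congr (Eventually.of_forall fun x => ?_))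
  by_cases hx : x ∈ Iic (0 : ℝ) <;> simp [indicator, hx]

theorem HasWeakDeriv.congr {f f' g g' : ℝ → ℝ} (h : HasWeakDeriv f g)
    (hf : f =ᵐ[volume.restrict (Iic 0)] f') (hg : g =ᵐ[volume.restrict (Iic 0)] g') :
    HasWeakDeriv f' g' where
  left := h.left.congr hf
  right := h.right.congr hg
  integral_eq φ h1 h2 h3 := by
    have e1 : ∫ ξ in Iic 0, f ξ * deriv φ ξ = ∫ ξ in Iic 0, f' ξ * deriv φ ξ :=
      integral_congr_ae (hf.mul (ae_eq_refl (deriv φ)))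
    have e2 : ∫ ξ in Iic 0, g ξ * φ ξ = ∫ ξ in Iic 0, g' ξ * φ ξ :=
      integral_congr_ae (hg.mul (ae_eq_refl φ))
    rw [← e1, ← e2]
    exact h.integral_eq φ h1 h2 h3

theorem HasWeakDeriv.add {f f' g g' : ℝ → ℝ} (h : HasWeakDeriv f g) (h' : HasWeakDeriv f' g') :
    HasWeakDeriv (f + f') (g + g') where
  left a := (h.left a).add (h'.left a)
  right a := (h.right a).add (h'.right a)
  integral_eq φ h1 h2 h3 := by
    have hd : Continuous (deriv φ) := h1.continuous_deriv le_rfl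
    simp only [Pi.add_apply, add_mul]
    rw [integral_add (h.left.integrable_mul hd h2.deriv) (h'.left.integrable_mul hd h2.deriv),
      integral_add (h.right.integrable_mul h1.continuous h2)
        (h'.right.integrable_mul h1.continuous h2),
      h.integral_eq φ h1 h2 h3, h'.integral_eq φ h1 h2 h3]
    ring

theorem HasWeakDeriv.const_smul {f g : ℝ → ℝ} (c : ℝ) (h : HasWeakDeriv f g) :
    HasWeakDeriv (c • f) (c • g) where
  left a := (h.left a).const_smul c
  right a := (h.right a).const_smul c
  integral_eq φ h1 h2 h3 := by
    simp only [Pi.smul_apply, smul_eq_mul, mul_assoc]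
    rw [integral_const_mul, integral_const_mul, h.integral_eq φ h1 h2 h3]
    ring

theorem HasWeakDeriv.unique {f g g' : ℝ → ℝ} (h : HasWeakDeriv f g) (h' : HasWeakDeriv f g') :
    g =ᵐ[volume.restrict (Iic 0)] g' := by
  have hl : MemL2loc (g - g') := fun a => (h.right a).sub (h'.right a)
  have key := isOpen_Iio (a := (0 : ℝ)) |>.ae_eq_zero_of_integral_contDiff_smul_eq_zero
    (μ := volume) (f := (Iic (0 : ℝ)).indicator (g - g'))
    (hl.locallyIntegrable.locallyIntegrableOn _) (by
      intro φ h1 h2 h3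
      have h1' : ContDiff ℝ 1 φ := h1.of_le (by norm_cast)
      have e1 := h.integral_eq φ h1' h2 h3
      have e2 := h'.integral_eq φ h1' h2 h3
      have e3 : (fun ξ => φ ξ • (Iic (0 : ℝ)).indicator (g - g') ξ)
          = (Iic (0 : ℝ)).indicator (fun ξ => g ξ * φ ξ - g' ξ * φ ξ) := by
        funext ξ
        by_cases hx : ξ ∈ Iic (0 : ℝ)
        · simp only [indicator_of_mem hx, Pi.sub_apply, smul_eq_mul]; ring
        · simp [indicator_of_notMem hx]
      rw [e3, integral_indicator measurableSet_Iic,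
        integral_sub (h.right.integrable_mul h1.continuous h2)
          (h'.right.integrable_mul h1.continuous h2)]
      linarith)
  rw [← restrict_Iio_eq_restrict_Iic]
  filter_upwards [ae_restrict_of_ae key, ae_restrict_mem measurableSet_Iio] with ξ hξ hm
  have := hξ hm
  rw [indicator_of_mem (mem_Iic.2 (le_of_lt hm))] at this
  exact sub_eq_zero.1 this

/-! ### The operator `𝒜` -/

/-- `{x = (x₀, x₁) ∈ H_w : x₁ ∈ W^{1,2}_w, x₀ = x₁(0)}`. -/
def domA (w : ℝ → ℝ) (hw : IsWeight w) : Submodule ℝ (Hw w) where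
  carrier := {x | MemW12 w x.snd ∧ HasValueAtZero x.snd x.fst}
  zero_mem' := by
    have h0 : ((0 : L2w w) : ℝ → ℝ) =ᵐ[volume.restrict (Iic 0)] 0 :=
      hw.ae_eq (Lp.coeFn_zero _ _ _)
    refine ⟨⟨Lp.memLp _, 0, ?_, MemLp.zero⟩, 0, ?_, h0, rfl⟩
    · have hz : HasWeakDeriv (0 : ℝ → ℝ) 0 :=
        ⟨fun a => MemLp.zero, fun a => MemLp.zero, fun φ _ _ _ => by simp⟩
      exact hz.congr h0.symm (ae_eq_refl _)
    · intro a _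
      exact (LipschitzWith.const (0 : ℝ)).lipschitzOnWith.absolutelyContinuousOnInterval
  add_mem' := by
    rintro x y ⟨⟨_, g, hg, hg2⟩, F, hF, hxF, hF0⟩ ⟨⟨_, g', hg', hg2'⟩, F', hF', hyF, hF0'⟩
    have h0 : ((x.snd + y.snd : L2w w) : ℝ → ℝ) =ᵐ[volume.restrict (Iic 0)] x.snd + y.snd :=
      hw.ae_eq (Lp.coeFn_add _ _)
    refine ⟨⟨Lp.memLp _, g + g', (hg.add hg').congr h0.symm (ae_eq_refl _), hg2.add hg2'⟩,
      F + F', fun a ha => (hF a ha).add (hF' a ha), h0.trans (hxF.add hyF), ?_⟩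
    simp [hF0, hF0']
  smul_mem' := by
    rintro c x ⟨⟨_, g, hg, hg2⟩, F, hF, hxF, hF0⟩
    have h0 : ((c • x.snd : L2w w) : ℝ → ℝ) =ᵐ[volume.restrict (Iic 0)] c • ⇑x.snd :=
      hw.ae_eq (Lp.coeFn_smul _ _)
    refine ⟨⟨Lp.memLp _, c • g, (hg.const_smul c).congr h0.symm (ae_eq_refl _), hg2.const_smul c⟩,
      c • F, fun a ha => (hF a ha).const_smul c, h0.trans (hxF.const_smul c), ?_⟩
    simp [hF0]

/-- The weak derivative `x₁' ∈ L²_w` of the second component of an element of the domain. -/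
noncomputable def weakDeriv {w : ℝ → ℝ} {hw : IsWeight w} (x : domA w hw) : L2w w :=
  x.2.1.2.choose_spec.2.toLp x.2.1.2.choose

theorem weakDeriv_spec {w : ℝ → ℝ} {hw : IsWeight w} (x : domA w hw) :
    HasWeakDeriv (x : Hw w).snd (weakDeriv x) :=
  x.2.1.2.choose_spec.1.congr (ae_eq_refl _)
    (hw.ae_eq (MemLp.coeFn_toLp x.2.1.2.choose_spec.2)).symm

theorem weakDeriv_eq {w : ℝ → ℝ} {hw : IsWeight w} (x : domA w hw) (y : L2w w)
    (h : HasWeakDeriv (x : Hw w).snd y) : weakDeriv x = y :=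
  Lp.ext ((weightMeasure_ac w).ae_le ((weakDeriv_spec x).unique h))

/-- The operator `𝒜 x = (0, x₁')` with domain `domA`. -/
noncomputable def opA (w : ℝ → ℝ) (hw : IsWeight w) : Hw w →ₗ.[ℝ] Hw w where
  domain := domA w hw
  toFun :=
    { toFun := fun x => WithLp.toLp 2 (0, weakDeriv x)
      map_add' := fun x y => by
        have h : weakDeriv (x + y) = weakDeriv x + weakDeriv y :=
          weakDeriv_eq _ _ (((weakDeriv_spec x).add (weakDeriv_spec y)).congr
            (hw.ae_eq (Lp.coeFn_add _ _)).symm (hw.ae_eq (Lp.coeFn_add _ _)).symm)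
        rw [h, ← WithLp.toLp_add, Prod.mk_add_mk, add_zero]
      map_smul' := fun c x => by
        have h : weakDeriv (c • x) = c • weakDeriv x :=
          weakDeriv_eq _ _ (((weakDeriv_spec x).const_smul c).congr
            (hw.ae_eq (Lp.coeFn_smul _ _)).symm (hw.ae_eq (Lp.coeFn_smul _ _)).symm)
        rw [h, RingHom.id_apply, ← WithLp.toLp_smul, Prod.smul_mk, smul_zero] }

end DelayShift

/-!
Extended by the constant `x₀` to `(0, ∞)`, the history `x₁` becomes a function on `ℝ` on which
`T t` acts as the left translation by `t`; this gives the semigroup law. The bound on `w' / w`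
makes `w (ξ - t) ≤ exp (K t) * w ξ`, so that translations are bounded on `L²_w`, locally uniformly
in `t`, and strong continuity follows from the case of smooth compactly supported functions.

Let `p x` be the extension of `x` and `P x` its primitive vanishing at `0`. Each `x ↦ P x a` is a
bounded functional on `H_w`, and together these functionals separate points. On the one hand,
`y = 𝒜 x` says exactly that `p x = x₀ + P y` almost everywhere. On the other hand,
`P (T t x - x) a = ∫_0^t (p x (a + s) - p x s) ds`, whose derivative at `t = 0` is `p x a - x₀` for
almost every `a`. Hence `𝒜` is the generator. Generators are closed and densely defined, so a
bounded one is everywhere defined; `𝒜` is not, as `(1, 0)` violates `x₀ = x₁(0)`.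
-/

namespace DelayShift

section Semigroup

variable {E : Type*} [NormedAddCommGroup E] [NormedSpace ℝ E] {T : ℝ≥0 → E →L[ℝ] E}
  {A : E →ₗ.[ℝ] E} {x y : E}

theorem tendsto_coe_nhdsGT_zero : Tendsto ((↑) : ℝ≥0 → ℝ) (𝓝[>] 0) (𝓝[>] 0) :=
  tendsto_nhdsWithin_iff.2
    ⟨(NNReal.continuous_coe.tendsto 0).mono_left nhdsWithin_le_nhds,
      eventually_mem_nhdsWithin.mono fun _ ↦ NNReal.coe_pos.2⟩

theorem tendsto_toNNReal_nhdsGT_zero : Tendsto Real.toNNReal (𝓝[>] 0) (𝓝[>] 0) :=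
  tendsto_nhdsWithin_iff.2
    ⟨(continuous_real_toNNReal.tendsto' 0 0 Real.toNNReal_zero).mono_left nhdsWithin_le_nhds,
      eventually_mem_nhdsWithin.mono fun _ ↦ Real.toNNReal_pos.2⟩

theorem isGenerator_iff_mem_graph : IsGenerator T A ↔ ∀ x y, (x, y) ∈ A.graph ↔
    Tendsto (fun t : ℝ≥0 ↦ (t : ℝ)⁻¹ • (T t x - x)) (𝓝[>] 0) (𝓝 y) := by
  refine ⟨fun hA x y ↦ ⟨?_, fun hy ↦ ?_⟩, fun h ↦ ⟨fun x ↦ ?_, fun x ↦ (h _ _).1 (A.mem_graph x)⟩⟩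
  · intro hxy
    obtain ⟨x, rfl, rfl⟩ := A.mem_graph_iff.1 hxy
    exact hA.tendsto x
  · have hx : x ∈ A.domain := (hA.mem_domain_iff x).2 ⟨y, hy⟩
    rw [tendsto_nhds_unique hy (hA.tendsto ⟨x, hx⟩)]
    exact A.mem_graph ⟨x, hx⟩
  · simp only [LinearPMap.mem_domain_iff, h]

namespace IsC0Semigroup

theorem continuous_toNNReal (hT : IsC0Semigroup T) (x : E) :
    Continuous fun s : ℝ ↦ T s.toNNReal x :=
  (hT.continuous_orbit x).comp continuous_real_toNNReal

theorem intervalIntegrable (hT : IsC0Semigroup T) (x : E) (a b : ℝ) :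
    IntervalIntegrable (fun s : ℝ ↦ T s.toNNReal x) volume a b :=
  (hT.continuous_toNNReal x).intervalIntegrable a b

theorem hasDerivWithinAt_orbit (hT : IsC0Semigroup T) {s : ℝ} (hs : 0 ≤ s)
    (h : Tendsto (fun t : ℝ≥0 ↦ (t : ℝ)⁻¹ • (T t x - x)) (𝓝[>] 0) (𝓝 y)) :
    HasDerivWithinAt (fun r : ℝ ↦ T r.toNNReal x) (T s.toNNReal y) (Ioi s) s := by
  rw [hasDerivWithinAt_iff_tendsto_slope' self_notMem_Ioi]
  have hsub : Tendsto (fun r ↦ r - s) (𝓝[>] s) (𝓝[>] 0) :=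
    tendsto_nhdsWithin_iff.2 ⟨((continuous_sub_right s).tendsto' s 0 (sub_self s)).mono_left
      nhdsWithin_le_nhds, eventually_mem_nhdsWithin.mono fun _ hr ↦ sub_pos.2 (mem_Ioi.1 hr)⟩
  have hlim := ((T s.toNNReal).continuous.tendsto y).comp
    (h.comp (tendsto_toNNReal_nhdsGT_zero.comp hsub))
  refine hlim.congr' (eventually_mem_nhdsWithin.mono fun r hr ↦ ?_)
  have hrs : 0 ≤ r - s := (sub_pos.2 hr).le
  have hr' : s.toNNReal + (r - s).toNNReal = r.toNNReal := by
    rw [← Real.toNNReal_add hs hrs, add_sub_cancel]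
  simp [slope_def_module, ← hr', hT.map_add, Real.coe_toNNReal _ hrs]

theorem tendsto_inv_smul_integral [CompleteSpace E] (hT : IsC0Semigroup T) (x : E) :
    Tendsto (fun t : ℝ≥0 ↦ (t : ℝ)⁻¹ • ∫ s in (0 : ℝ)..t, T s.toNNReal x) (𝓝[>] 0) (𝓝 x) := by
  have hderiv := ((hT.continuous_toNNReal x).integral_hasStrictDerivAt 0 0).hasDerivAt
  simpa [Function.comp_def, hT.map_zero] using
    hderiv.tendsto_slope_zero_right.comp tendsto_coe_nhdsGT_zero

theorem tendsto_iff_eq_integral [CompleteSpace E] (hT : IsC0Semigroup T) :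
    Tendsto (fun t : ℝ≥0 ↦ (t : ℝ)⁻¹ • (T t x - x)) (𝓝[>] 0) (𝓝 y) ↔
      ∀ t : ℝ≥0, T t x - x = ∫ s in (0 : ℝ)..t, T s.toNNReal y := by
  refine ⟨fun h t ↦ ?_, fun h ↦ by simpa only [h] using hT.tendsto_inv_smul_integral y⟩
  rw [intervalIntegral.integral_eq_sub_of_hasDeriv_right_of_le t.coe_nonneg
    (hT.continuous_toNNReal x).continuousOn (fun s hs ↦ hT.hasDerivWithinAt_orbit hs.1.le h)
    (hT.intervalIntegrable y _ _)]
  simp [hT.map_zero]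

theorem exists_norm_le [CompleteSpace E] (hT : IsC0Semigroup T) (R : ℝ≥0) :
    ∃ M : ℝ, ∀ t ≤ R, ‖T t‖ ≤ M := by
  obtain ⟨M, hM⟩ := banach_steinhaus (g := fun t : Icc (0 : ℝ≥0) R ↦ T t) fun x ↦ by
    obtain ⟨C, hC⟩ := isCompact_Icc.exists_bound_of_continuousOn
      (hT.continuous_orbit x).continuousOn (s := Icc 0 R)
    exact ⟨C, fun t ↦ hC t t.2⟩
  exact ⟨M, fun t ht ↦ hM ⟨t, zero_le, ht⟩⟩

theorem continuous_integral [CompleteSpace E] (hT : IsC0Semigroup T) (t : ℝ≥0) :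
    Continuous fun y ↦ ∫ s in (0 : ℝ)..t, T s.toNNReal y := by
  obtain ⟨M, hM⟩ := hT.exists_norm_le t
  have hM0 : 0 ≤ M := (norm_nonneg _).trans (hM t le_rfl)
  refine (LipschitzWith.of_dist_le_mul (K := M.toNNReal * t) fun y z ↦ ?_).continuous
  rw [dist_eq_norm, dist_eq_norm, ← intervalIntegral.integral_sub
    (hT.intervalIntegrable y _ _) (hT.intervalIntegrable z _ _)]
  refine (intervalIntegral.norm_integral_le_of_norm_le_const (C := M * ‖y - z‖)
    fun s hs ↦ ?_).trans_eq ?_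
  · rw [uIoc_of_le t.coe_nonneg] at hs
    rw [← map_sub]
    exact (T _).le_of_opNorm_le (hM _ (Real.toNNReal_le_iff_le_coe.2 hs.2)) _
  · rw [sub_zero, abs_of_nonneg t.coe_nonneg, NNReal.coe_mul, Real.coe_toNNReal M hM0]
    ring

theorem map_integral [CompleteSpace E] (hT : IsC0Semigroup T) (t r : ℝ≥0) (x : E) :
    T t (∫ s in (0 : ℝ)..r, T s.toNNReal x) = ∫ s in (t : ℝ)..t + r, T s.toNNReal x := by
  rw [← (T t).intervalIntegral_comp_comm (hT.intervalIntegrable x _ _)]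
  have hadd : ∀ s ∈ uIcc (0 : ℝ) r, T t (T s.toNNReal x) = T (t + s).toNNReal x := by
    intro s hs
    rw [uIcc_of_le r.coe_nonneg] at hs
    rw [Real.toNNReal_add t.coe_nonneg hs.1, Real.toNNReal_coe, hT.map_add]
    rfl
  rw [intervalIntegral.integral_congr hadd,
    intervalIntegral.integral_comp_add_left (fun s ↦ T s.toNNReal x), add_zero]

end IsC0Semigroup

namespace IsGenerator

variable [CompleteSpace E]

theorem mem_graph_iff_eq_integral (hA : IsGenerator T A) (hT : IsC0Semigroup T) :
    (x, y) ∈ A.graph ↔ ∀ t : ℝ≥0, T t x - x = ∫ s in (0 : ℝ)..t, T s.toNNReal y :=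
  (isGenerator_iff_mem_graph.1 hA x y).trans hT.tendsto_iff_eq_integral

theorem isClosed (hA : IsGenerator T A) (hT : IsC0Semigroup T) : A.IsClosed := by
  have hgraph : (A.graph : Set (E × E))
      = ⋂ t : ℝ≥0, {p | T t p.1 - p.1 = ∫ s in (0 : ℝ)..t, T s.toNNReal p.2} := by
    ext ⟨x, y⟩
    simpa using hA.mem_graph_iff_eq_integral hT
  rw [LinearPMap.IsClosed, hgraph]
  exact isClosed_iInter fun t ↦ isClosed_eq (by fun_prop)
    ((hT.continuous_integral t).comp continuous_snd)

theorem integral_mem_domain (hA : IsGenerator T A) (hT : IsC0Semigroup T) (x : E) (r : ℝ≥0) :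
    ∫ s in (0 : ℝ)..r, T s.toNNReal x ∈ A.domain := by
  refine LinearPMap.mem_domain_iff.2 ⟨T r x - x, (hA.mem_graph_iff_eq_integral hT).2 fun t ↦ ?_⟩
  have hr : ∫ s in (0 : ℝ)..t, T s.toNNReal (T r x) = ∫ s in (r : ℝ)..r + t, T s.toNNReal x := by
    rw [← hT.map_integral, ← (T r).intervalIntegral_comp_comm (hT.intervalIntegrable x _ _)]
    simp only [← ContinuousLinearMap.comp_apply, ← hT.map_add, add_comm]
  have hint := hT.intervalIntegrable x
  simp only [map_sub]
  rw [intervalIntegral.integral_sub (hT.intervalIntegrable _ _ _) (hint _ _), hr,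
    hT.map_integral, add_comm (r : ℝ),
    intervalIntegral.integral_interval_sub_interval_comm' (hint _ _) (hint _ _) (hint _ _)]

theorem dense_domain (hA : IsGenerator T A) (hT : IsC0Semigroup T) :
    Dense (A.domain : Set E) := fun x ↦
  mem_closure_of_tendsto (hT.tendsto_inv_smul_integral x)
    (Eventually.of_forall fun t ↦ A.domain.smul_mem _ (hA.integral_mem_domain hT x t))

end IsGenerator

theorem isClosed_domain_of_norm_le [CompleteSpace E] (hA : A.IsClosed) {C : ℝ}
    (hC : ∀ x : A.domain, ‖A x‖ ≤ C * ‖(x : E)‖) : IsClosed (A.domain : Set E) := by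
  have : CompleteSpace A.graph := hA.completeSpace_coe
  let proj : A.graph →ₗ[ℝ] E := LinearMap.fst ℝ E E ∘ₗ A.graph.subtype
  have hanti : AntilipschitzWith (max 1 C.toNNReal) proj := by
    refine AddMonoidHomClass.antilipschitz_of_bound proj fun p ↦ ?_
    obtain ⟨x, hx, hy⟩ := A.mem_graph_iff.1 p.2
    change ‖(p : E × E)‖ ≤ _ * ‖(p : E × E).1‖
    rw [Prod.norm_def, ← hx, ← hy, NNReal.coe_max, NNReal.coe_one, max_mul_of_nonneg _ _
      (norm_nonneg _), one_mul]
    gcongr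
    exact (hC x).trans (by gcongr; exact Real.le_coe_toNNReal C)
  have hrange : (A.domain : Set E) = range proj := by
    ext x
    exact LinearPMap.mem_domain_iff.trans
      ⟨fun ⟨y, hy⟩ ↦ ⟨⟨(x, y), hy⟩, rfl⟩, fun ⟨p, hp⟩ ↦ ⟨p.1.2, hp ▸ p.2⟩⟩
  rw [hrange]
  exact hanti.isClosed_range (uniformContinuous_fst.comp uniformContinuous_subtype_val)

theorem IsGenerator.not_bounded [CompleteSpace E] (hA : IsGenerator T A) (hT : IsC0Semigroup T)
    (hdom : A.domain ≠ ⊤) : ¬ ∃ C : ℝ, ∀ x : A.domain, ‖A x‖ ≤ C * ‖(x : E)‖ := fun ⟨_, hC⟩ ↦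
  hdom <| SetLike.coe_injective <|
    (isClosed_domain_of_norm_le (hA.isClosed hT) hC).closure_eq ▸ (hA.dense_domain hT).closure_eq

end Semigroup

section Weight

variable {w f : ℝ → ℝ} {K : ℝ}

theorem IsWeight.monotoneOn_mul_exp (hw : IsWeight w)
    (hK : ∀ ξ ∈ Iic (0 : ℝ), |derivWithin w (Iic 0) ξ / w ξ| ≤ K) :
    MonotoneOn (fun ξ ↦ w ξ * Real.exp (K * ξ)) (Iic 0) := by
  have hderiv : ∀ ξ ∈ Iio (0 : ℝ), HasDerivAt (fun ξ ↦ w ξ * Real.exp (K * ξ))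
      (derivWithin w (Iic 0) ξ * Real.exp (K * ξ) + w ξ * (Real.exp (K * ξ) * K)) ξ := by
    intro ξ hξ
    have hwξ : HasDerivAt w (derivWithin w (Iic 0) ξ) ξ :=
      (hw.contDiffOn.differentiableOn one_ne_zero ξ (mem_Iio.1 hξ).le).hasDerivWithinAt.hasDerivAt
        (Iic_mem_nhds hξ)
    simpa using! hwξ.mul ((hasDerivAt_id ξ).const_mul K).exp
  refine monotoneOn_of_hasDerivWithinAt_nonneg (convex_Iic 0)
    (hw.contDiffOn.continuousOn.mul (by fun_prop))
    (fun ξ hξ ↦ (hderiv ξ (by simpa using hξ)).hasDerivWithinAt) fun ξ hξ ↦ ?_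
  have hξ' : ξ ∈ Iic (0 : ℝ) := interior_subset hξ
  have hlog := (abs_le.1 (hK ξ hξ')).1
  rw [le_div_iff₀ (hw.pos ξ hξ')] at hlog
  nlinarith [Real.exp_pos (K * ξ)]

theorem IsWeight.exists_forall_le_exp_mul (hw : IsWeight w) :
    ∃ K : ℝ, ∀ t : ℝ≥0, ∀ ξ ≤ 0, w (ξ - t) ≤ Real.exp (K * t) * w ξ := by
  obtain ⟨K, hK⟩ := hw.bounded
  refine ⟨K, fun t ξ hξ ↦ ?_⟩
  have hmono := hw.monotoneOn_mul_exp hK (by simp; linarith [t.coe_nonneg]) hξ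
    (sub_le_self ξ t.coe_nonneg)
  refine le_of_mul_le_mul_right (hmono.trans_eq ?_) (Real.exp_pos (K * (ξ - t)))
  rw [mul_right_comm, ← Real.exp_add, mul_comm]
  ring_nf

theorem IsWeight.isLocallyFiniteMeasure (hw : IsWeight w) :
    IsLocallyFiniteMeasure (weightMeasure w) := by
  have hcongr : weightMeasure w
      = (volume.restrict (Iic 0)).withDensity fun ξ ↦ ENNReal.ofReal (w (min ξ 0)) :=
    withDensity_congr_ae <| (ae_restrict_mem measurableSet_Iic).mono fun ξ hξ ↦ by
      simp only [min_eq_left (mem_Iic.1 hξ)]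
  rw [hcongr]
  exact .withDensity_ofReal <| hw.contDiffOn.continuousOn.comp_continuous
    (continuous_id.min continuous_const) fun ξ ↦ min_le_right ξ 0

theorem IsWeight.exists_restrict_Icc_le (hw : IsWeight w) (a : ℝ) :
    ∃ c : ℝ≥0∞, c ≠ ∞ ∧ volume.restrict (Icc a 0) ≤ c • weightMeasure w := by
  obtain ⟨m, hm, hmw⟩ := isCompact_Icc.exists_forall_le' (s := Icc a 0)
    (hw.contDiffOn.continuousOn.mono Icc_subset_Iic_self) (a := 0)
    fun ξ hξ ↦ hw.pos ξ hξ.2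
  have hle : ENNReal.ofReal m • volume.restrict (Icc a 0) ≤ weightMeasure w := calc
    _ = (volume.restrict (Icc a 0)).withDensity fun _ ↦ ENNReal.ofReal m :=
      (withDensity_const _).symm
    _ ≤ (volume.restrict (Icc a 0)).withDensity fun ξ ↦ ENNReal.ofReal (w ξ) :=
      withDensity_mono <| (ae_restrict_mem measurableSet_Icc).mono fun ξ hξ ↦
        ENNReal.ofReal_le_ofReal (hmw ξ hξ)
    _ = (weightMeasure w).restrict (Icc a 0) := by
      rw [weightMeasure, restrict_withDensity measurableSet_Icc,
        Measure.restrict_restrict measurableSet_Icc, inter_eq_left.2 Icc_subset_Iic_self]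
    _ ≤ weightMeasure w := Measure.restrict_le_self
  have hm0 : ENNReal.ofReal m ≠ 0 := by simpa using hm
  refine ⟨(ENNReal.ofReal m)⁻¹, ENNReal.inv_ne_top.2 hm0, ?_⟩
  calc volume.restrict (Icc a 0)
      = (ENNReal.ofReal m)⁻¹ • ENNReal.ofReal m • volume.restrict (Icc a 0) := by
        rw [smul_smul, ENNReal.inv_mul_cancel hm0 ENNReal.ofReal_ne_top, one_smul]
    _ ≤ (ENNReal.ofReal m)⁻¹ • weightMeasure w := by gcongr

theorem IsWeight.memL2loc (hw : IsWeight w) (hf : MemLp f 2 (weightMeasure w)) :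
    MemL2loc f := fun a ↦ by
  obtain ⟨c, hc, h⟩ := hw.exists_restrict_Icc_le a
  exact hf.of_measure_le_smul hc h

theorem map_add_left_withDensity {G : Type*} [AddGroup G] [MeasurableSpace G] [MeasurableAdd G]
    (μ : Measure G) [μ.IsAddLeftInvariant] (ρ : G → ℝ≥0∞) (g : G) :
    (μ.withDensity ρ).map (g + ·) = μ.withDensity fun x ↦ ρ (-g + x) := by
  ext s hs
  have hg : MeasurableSet ((g + ·) ⁻¹' s) := measurable_const_add g hs
  rw [Measure.map_apply (measurable_const_add g) hs, withDensity_apply _ hg, withDensity_apply _ hs]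
  simpa only [neg_add_cancel_left] using
    (measurePreserving_add_left μ g).setLIntegral_comp_preimage_emb
      (MeasurableEquiv.addLeft g).measurableEmbedding (fun x ↦ ρ (-g + x)) s

theorem restrict_map_weightMeasure_le {c t : ℝ} (hc : 0 ≤ c)
    (h : ∀ ξ ≤ 0, w (ξ - t) ≤ c * w ξ) :
    ((weightMeasure w).map (t + ·)).restrict (Iic 0) ≤ ENNReal.ofReal c • weightMeasure w := by
  rw [weightMeasure, ← withDensity_indicator measurableSet_Iic, map_add_left_withDensity,
    restrict_withDensity measurableSet_Iic, withDensity_indicator measurableSet_Iic,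
    ← withDensity_smul' _ _ ENNReal.ofReal_ne_top]
  refine withDensity_mono <| (ae_restrict_mem measurableSet_Iic).mono fun ξ hξ ↦ ?_
  refine (indicator_le_self' (fun _ _ ↦ zero_le) _).trans ?_
  rw [Pi.smul_apply, smul_eq_mul, ← ENNReal.ofReal_mul hc, neg_add_eq_sub]
  exact ENNReal.ofReal_le_ofReal (h ξ hξ)

end Weight

section LpIndicatorComp

variable {α β E : Type*} [MeasurableSpace α] [MeasurableSpace β] [NormedAddCommGroup E]
  [NormedSpace ℝ E] {p : ℝ≥0∞} [Fact (1 ≤ p)] {μ : Measure α} {ν : Measure β} {s : Set β}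
  {φ : α → β} {c : ℝ≥0∞}

variable (p ν) in
/-- Extension by zero of `Lᵖ` functions from a measurable set to the whole space. -/
noncomputable def extendByZeroₗᵢ (hs : MeasurableSet s) :
    Lp E p (ν.restrict s) →ₗᵢ[ℝ] Lp E p ν where
  toFun f := ((memLp_indicator_iff_restrict hs).2 (Lp.memLp f)).toLp (s.indicator f)
  map_add' f g := by
    rw [← MemLp.toLp_add, MemLp.toLp_eq_toLp_iff, ← indicator_add',
      ← ae_eq_restrict_iff_indicator_ae_eq hs]
    exact Lp.coeFn_add f g
  map_smul' r f := by
    rw [RingHom.id_apply, ← MemLp.toLp_const_smul, MemLp.toLp_eq_toLp_iff,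
      show r • s.indicator f = s.indicator (r • ⇑f) from (indicator_const_smul s r f).symm,
      ← ae_eq_restrict_iff_indicator_ae_eq hs]
    exact Lp.coeFn_smul r f
  norm_map' f := by
    change ‖((memLp_indicator_iff_restrict hs).2 (Lp.memLp f)).toLp (s.indicator f)‖ = ‖f‖
    rw [Lp.norm_toLp, eLpNorm_indicator_eq_eLpNorm_restrict hs, Lp.norm_def]

theorem coeFn_extendByZeroₗᵢ (hs : MeasurableSet s) (f : Lp E p (ν.restrict s)) :
    extendByZeroₗᵢ p ν hs f =ᵐ[ν] s.indicator f := by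
  have hf : MemLp (s.indicator f) p ν := (memLp_indicator_iff_restrict hs).2 (Lp.memLp f)
  have hext : extendByZeroₗᵢ p ν hs f = hf.toLp (s.indicator f) := rfl
  rw [hext]
  exact hf.coeFn_toLp

/-- The operator `f ↦ (s.indicator f) ∘ φ` from `Lᵖ(ν)` to `Lᵖ(μ)`; it is bounded as soon as, on
`s`, the image of `μ` under `φ` is at most a multiple of `ν`. -/
noncomputable def indicatorCompL (hφ : Measurable φ) (hs : MeasurableSet s) (hc : c ≠ ∞)
    (h : (μ.map φ).restrict s ≤ c • ν) : Lp E p ν →L[ℝ] Lp E p μ :=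
  let comp : Lp E p (μ.map φ) →ₗᵢ[ℝ] Lp E p μ :=
    Lp.compMeasurePreservingₗᵢ ℝ φ (hφ.measurePreserving μ)
  (comp.comp (extendByZeroₗᵢ p (μ.map φ) hs)).toContinuousLinearMap ∘L
    Lp.LpToLpOfMeasureLeSMul hc h

theorem coeFn_indicatorCompL (hφ : Measurable φ) (hs : MeasurableSet s) (hc : c ≠ ∞)
    (h : (μ.map φ).restrict s ≤ c • ν) (f : Lp E p ν) :
    indicatorCompL hφ hs hc h f =ᵐ[μ] fun x ↦ s.indicator f (φ x) := by
  have hmp := hφ.measurePreserving μ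
  let g : Lp E p ((μ.map φ).restrict s) := Lp.LpToLpOfMeasureLeSMul hc h f
  calc ⇑(indicatorCompL hφ hs hc h f)
      = ⇑(Lp.compMeasurePreserving φ hmp (extendByZeroₗᵢ p (μ.map φ) hs g)) := rfl
    _ =ᵐ[μ] extendByZeroₗᵢ p (μ.map φ) hs g ∘ φ := Lp.coeFn_compMeasurePreserving _ hmp
    _ =ᵐ[μ] s.indicator f ∘ φ := ae_eq_comp hφ.aemeasurable <|
      (coeFn_extendByZeroₗᵢ hs g).trans <| (ae_eq_restrict_iff_indicator_ae_eq hs).1 <|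
        Lp.coeFn_LpToLpOfMeasureLeSMul hc h f

theorem norm_indicatorCompL_le (hφ : Measurable φ) (hs : MeasurableSet s) (hc : c ≠ ∞)
    (h : (μ.map φ).restrict s ≤ c • ν) :
    ‖(indicatorCompL hφ hs hc h : Lp E p ν →L[ℝ] Lp E p μ)‖ ≤ c.toReal ^ (1 / p).toReal :=
  ((LinearIsometry.norm_toContinuousLinearMap_comp _).trans_le
    (Lp.norm_LpToLpOfMeasureLeSMul_le hc h))

end LpIndicatorComp

section LeftShift

variable {w : ℝ → ℝ}

theorem IsWeight.exists_leftShift (hw : IsWeight w) :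
    ∃ (K : ℝ) (S : ℝ≥0 → L2w w →L[ℝ] L2w w), (∀ t, ‖S t‖ ≤ √(Real.exp (K * t))) ∧
      ∀ t f, S t f =ᵐ[weightMeasure w] fun ξ ↦ (Iic 0).indicator f (t + ξ) := by
  obtain ⟨K, hK⟩ := hw.exists_forall_le_exp_mul
  have hle (t : ℝ≥0) := restrict_map_weightMeasure_le (Real.exp_pos (K * t)).le (hK t)
  refine ⟨K, fun t ↦ indicatorCompL (measurable_const_add (t : ℝ)) measurableSet_Iic
    ENNReal.ofReal_ne_top (hle t), fun t ↦ ?_, fun t ↦ coeFn_indicatorCompL _ _ _ _⟩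
  refine (norm_indicatorCompL_le _ _ _ _).trans_eq ?_
  rw [Real.sqrt_eq_rpow, ENNReal.toReal_ofReal (Real.exp_pos _).le]
  norm_num

end LeftShift

section StrongContinuity

theorem tendsto_eLpNorm_zero_of_dominated {α ι E : Type*} [MeasurableSpace α] {μ : Measure α}
    [NormedAddCommGroup E] {l : Filter ι} [l.IsCountablyGenerated] {p : ℝ≥0∞} (hp : p ≠ ∞)
    {F : ι → α → E} {bound : α → ℝ} (hF : ∀ᶠ i in l, AEStronglyMeasurable (F i) μ)
    (hbound : MemLp bound p μ) (hle : ∀ᶠ i in l, ∀ᵐ a ∂μ, ‖F i a‖ ≤ bound a)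
    (hlim : ∀ᵐ a ∂μ, Tendsto (fun i ↦ F i a) l (𝓝 0)) :
    Tendsto (fun i ↦ eLpNorm (F i) p μ) l (𝓝 0) := by
  rcases eq_or_ne p 0 with rfl | hp0
  · simpa using tendsto_const_nhds
  have hp' : 0 < p.toReal := ENNReal.toReal_pos hp0 hp
  simp only [eLpNorm_eq_lintegral_rpow_enorm_toReal hp0 hp]
  have hint : Tendsto (fun i ↦ ∫⁻ a, ‖F i a‖ₑ ^ p.toReal ∂μ) l (𝓝 (∫⁻ _, 0 ∂μ)) := by
    refine tendsto_lintegral_filter_of_dominated_convergence' (fun a ↦ ‖bound a‖ₑ ^ p.toReal)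
      (hF.mono fun i hi ↦ hi.enorm.pow_const _) (hle.mono fun i hi ↦ hi.mono fun a ha ↦ ?_)
      (lintegral_rpow_enorm_lt_top_of_eLpNorm_lt_top hp0 hp hbound.2).ne
      (hlim.mono fun a ha ↦ ?_)
    · gcongr
      exact enorm_le_iff_norm_le.2 (ha.trans (Real.le_norm_self _))
    · simpa [hp'] using ha.enorm.ennrpow_const p.toReal
  simpa [hp'] using hint.ennrpow_const (1 / p.toReal)

theorem continuous_Lp_translate {E : Type*} [NormedAddCommGroup E] {p : ℝ≥0∞} [Fact (1 ≤ p)]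
    (hp : p ≠ ∞) {μ : Measure ℝ} [IsLocallyFiniteMeasure μ] (hμ : μ ≪ volume.restrict (Iic 0))
    {h : ℝ → E} {b R C : ℝ} (hcont : ∀ η ≠ b, ContinuousAt h η) (hC : ∀ η, ‖h η‖ ≤ C)
    (hR : ∀ η < R, h η = 0) {U : ℝ≥0 → Lp E p μ} (hU : ∀ t, U t =ᵐ[μ] fun ξ ↦ h (t + ξ)) :
    Continuous U := by
  refine continuous_iff_continuousAt.2 fun t₀ ↦ ?_
  have hmeas (t : ℝ≥0) : AEStronglyMeasurable (fun ξ ↦ h (t + ξ)) μ :=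
    (Lp.aestronglyMeasurable (U t)).congr (hU t)
  have hbound : MemLp ((Icc (R - t₀ - 1) 0).indicator fun _ ↦ C + C) p μ :=
    memLp_indicator_const p measurableSet_Icc _ (.inr isCompact_Icc.measure_lt_top.ne)
  have hne : ∀ᵐ ξ ∂μ, ξ ≠ b - t₀ := hμ.ae_le (ae_restrict_of_ae (Measure.ae_ne volume _))
  rw [ContinuousAt, Lp.tendsto_Lp_iff_tendsto_eLpNorm']
  simp only [eLpNorm_congr_ae ((hU _).sub (hU t₀))]
  refine tendsto_eLpNorm_zero_of_dominated hp
    (.of_forall fun t ↦ (hmeas t).sub (hmeas t₀)) hbound ?_ (hne.mono fun ξ hξ ↦ ?_)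
  · filter_upwards [Iio_mem_nhds (lt_add_one t₀)] with t ht
    filter_upwards [hμ.ae_le (ae_restrict_mem measurableSet_Iic)] with ξ hξ
    have ht' : (t : ℝ) < t₀ + 1 := by exact_mod_cast mem_Iio.1 ht
    by_cases hξR : R - t₀ - 1 ≤ ξ
    · rw [indicator_of_mem (show ξ ∈ Icc (R - t₀ - 1) 0 from ⟨hξR, hξ⟩)]
      exact (norm_sub_le _ _).trans (add_le_add (hC _) (hC _))
    · rw [indicator_of_notMem (fun h' ↦ hξR h'.1), Pi.sub_apply,
        hR _ (by linarith), hR _ (by linarith), sub_zero, norm_zero]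
  · have hadd : ContinuousAt (fun t : ℝ≥0 ↦ (t : ℝ) + ξ) t₀ := by fun_prop
    have hb : (t₀ : ℝ) + ξ ≠ b := fun h' ↦ hξ (eq_sub_of_add_eq' h')
    have hlim := (ContinuousAt.comp (f := fun t : ℝ≥0 ↦ (t : ℝ) + ξ) (hcont _ hb) hadd).tendsto
    simpa using hlim.sub_const (h (t₀ + ξ))

theorem continuous_apply_of_dense {X E F : Type*} [TopologicalSpace X] [NormedAddCommGroup E]
    [NormedSpace ℝ E] [NormedAddCommGroup F] [NormedSpace ℝ F] {S : X → E →L[ℝ] F} {B : X → ℝ}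
    (hB : Continuous B) (hS : ∀ t, ‖S t‖ ≤ B t) {D : Set E} (hD : Dense D)
    (hcont : ∀ x ∈ D, Continuous fun t ↦ S t x) (x : E) : Continuous fun t ↦ S t x := by
  refine continuous_of_locally_uniform_approx_of_continuousAt fun t₀ u hu ↦ ?_
  obtain ⟨ε, hε, hεu⟩ := Metric.mem_uniformity_dist.1 hu
  have hM : 0 < B t₀ + 1 := by linarith [(norm_nonneg _).trans (hS t₀)]
  obtain ⟨y, hyD, hy⟩ := hD.exists_dist_lt x (div_pos hε hM)
  refine ⟨{t | B t < B t₀ + 1}, hB.continuousAt.eventually_lt_const (lt_add_one _),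
    fun t ↦ S t y, (hcont y hyD).continuousAt, fun t ht ↦ hεu ?_⟩
  rw [dist_eq_norm, ← map_sub]
  calc ‖S t (x - y)‖ ≤ (B t₀ + 1) * ‖x - y‖ :=
        (S t).le_of_opNorm_le ((hS t).trans (le_of_lt ht)) _
    _ < ε := by rwa [← dist_eq_norm, mul_comm, ← lt_div_iff₀ hM]

variable {w : ℝ → ℝ}

theorem ae_eq_comp_const_add {E : Type*} {f g : ℝ → E} (h : f =ᵐ[volume] g) (t : ℝ) :
    (fun ξ ↦ f (t + ξ)) =ᵐ[volume] fun ξ ↦ g (t + ξ) :=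
  (measurePreserving_add_left volume t).quasiMeasurePreserving.ae_eq_comp h

theorem weightMeasure_ac_volume (w : ℝ → ℝ) : weightMeasure w ≪ volume :=
  (weightMeasure_ac w).trans Measure.restrict_le_self.absolutelyContinuous

theorem IsWeight.ae_eq_indicator (hw : IsWeight w) {f g : ℝ → ℝ}
    (h : f =ᵐ[weightMeasure w] g) : (Iic (0 : ℝ)).indicator f =ᵐ[volume] (Iic 0).indicator g :=
  (ae_eq_restrict_iff_indicator_ae_eq measurableSet_Iic).1 (hw.ae_eq h)

theorem IsWeight.continuous_leftShift (hw : IsWeight w) {B : ℝ≥0 → ℝ} (hB : Continuous B)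
    {S : ℝ≥0 → L2w w →L[ℝ] L2w w} (hSB : ∀ t, ‖S t‖ ≤ B t)
    (hS : ∀ t f, S t f =ᵐ[weightMeasure w] fun ξ ↦ (Iic 0).indicator f (t + ξ)) (f : L2w w) :
    Continuous fun t ↦ S t f := by
  have := hw.isLocallyFiniteMeasure
  refine continuous_apply_of_dense hB hSB (Lp.dense_hasCompactSupport_contDiff ENNReal.ofNat_ne_top)
    (fun f ⟨g, hfg, hg, hg'⟩ ↦ ?_) f
  obtain ⟨C, hC⟩ := hg.exists_bound_of_continuous hg'.continuous
  obtain ⟨R, hR⟩ := hg.isCompact.bddBelow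
  refine continuous_Lp_translate (h := (Iic 0).indicator g) (b := 0) (R := R) (C := C)
    ENNReal.ofNat_ne_top (weightMeasure_ac w) (fun η hη ↦ ?_) (fun η ↦ ?_) (fun η hη ↦ ?_)
    fun t ↦ (hS t f).trans <| (weightMeasure_ac_volume w).ae_le <|
      ae_eq_comp_const_add (hw.ae_eq_indicator hfg) t
  · exact hg'.continuous.continuousOn.continuousAt_indicator (by simpa using hη)
  · exact (norm_indicator_le_norm_self g η).trans (hC η)
  · have : η ∉ tsupport g := fun h ↦ (hR h).not_gt hη
    simp [indicator, image_eq_zero_of_notMem_tsupport this]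

theorem exists_continuous_indicatorConstLp_Ioc {μ : Measure ℝ} [IsLocallyFiniteMeasure μ]
    (hμ : μ ≪ volume.restrict (Iic 0)) : ∃ u : ℝ≥0 → Lp ℝ 2 μ, Continuous u ∧
      ∀ t, u t =ᵐ[μ] fun ξ ↦ (Ioi (0 : ℝ)).indicator 1 (t + ξ) := by
  let u (t : ℝ≥0) : Lp ℝ 2 μ := indicatorConstLp 2 measurableSet_Ioc measure_Ioc_lt_top.ne
    (s := Ioc (-(t : ℝ)) 0) 1
  have hu (t : ℝ≥0) : u t =ᵐ[μ] fun ξ ↦ (Ioi (0 : ℝ)).indicator 1 (t + ξ) := by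
    filter_upwards [indicatorConstLp_coeFn (p := 2) (hs := measurableSet_Ioc)
      (hμs := (measure_Ioc_lt_top (μ := μ) (a := -(t : ℝ)) (b := 0)).ne) (c := (1 : ℝ)),
      hμ.ae_le (ae_restrict_mem measurableSet_Iic)] with ξ hξ hξ0
    rw [hξ]
    simp only [indicator, mem_Ioc, mem_Ioi, neg_lt_iff_pos_add', mem_Iic.1 hξ0, and_true,
      Pi.one_apply]
  refine ⟨u, continuous_Lp_translate (b := 0) (R := 0) (C := 1) ENNReal.ofNat_ne_top hμ
    (fun η hη ↦ ?_) (fun η ↦ ?_) (fun η hη ↦ ?_) hu, hu⟩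
  · exact continuousOn_const.continuousAt_indicator (by simpa using hη)
  · exact (norm_indicator_le_norm_self _ η).trans (by simp)
  · exact indicator_of_notMem (by simpa using hη.le) _

end StrongContinuity

section Profile

variable {w : ℝ → ℝ}

/-- The second component of `T t x` is the left translate by `t` of this function, for every
`t ≥ 0`: constancy on `(0, ∞)` encodes the boundary input `x₀ 1_{(0,t]}(t + ·)`. -/
noncomputable def profile (x : Hw w) (η : ℝ) : ℝ :=
  if η ≤ 0 then x.snd η else x.fst

theorem profile_of_nonpos (x : Hw w) {η : ℝ} (hη : η ≤ 0) : profile x η = x.snd η :=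
  if_pos hη

theorem profile_of_pos (x : Hw w) {η : ℝ} (hη : 0 < η) : profile x η = x.fst :=
  if_neg hη.not_ge

theorem profile_eq_indicator_add (x : Hw w) :
    profile x = (Iic 0).indicator x.snd + (Ioi 0).indicator fun _ ↦ x.fst := by
  ext η
  rcases le_or_gt η 0 with hη | hη
  · simp [profile_of_nonpos x hη, hη, hη.not_gt]
  · simp [profile_of_pos x hη, hη, hη.not_ge]

theorem shiftFun_eq_profile (t : ℝ≥0) (x : Hw w) {ξ : ℝ} (hξ : ξ ≤ 0) :
    shiftFun t x.fst x.snd ξ = profile x (t + ξ) := by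
  rcases le_or_gt ((t : ℝ) + ξ) 0 with h | h
  · simp [shiftFun, profile_of_nonpos x h, h, h.not_gt]
  · simp [shiftFun, profile_of_pos x h, h, h.not_ge, hξ]

theorem ae_le_zero_weightMeasure (w : ℝ → ℝ) : ∀ᵐ ξ ∂weightMeasure w, ξ ≤ 0 :=
  (weightMeasure_ac w).ae_le (ae_restrict_mem measurableSet_Iic)

theorem isShiftFamily_iff {T : ℝ≥0 → Hw w →L[ℝ] Hw w} :
    IsShiftFamily w T ↔ ∀ t x, (T t x).fst = x.fst ∧
      (T t x).snd =ᵐ[weightMeasure w] fun ξ ↦ profile x (t + ξ) := by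
  refine forall₂_congr fun t x ↦ and_congr_right fun _ ↦ ?_
  have h : shiftFun t x.fst x.snd =ᵐ[weightMeasure w] fun ξ ↦ profile x (t + ξ) :=
    (ae_le_zero_weightMeasure w).mono fun ξ hξ ↦ shiftFun_eq_profile t x hξ
  exact ⟨fun h' ↦ h'.trans h, fun h' ↦ h'.trans h.symm⟩

theorem IsWeight.exists_isShiftFamily (hw : IsWeight w) : ∃ T : ℝ≥0 → Hw w →L[ℝ] Hw w,
    IsShiftFamily w T ∧ ∀ x, Continuous fun t ↦ T t x := by
  have := hw.isLocallyFiniteMeasure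
  obtain ⟨K, S, hSK, hS⟩ := hw.exists_leftShift
  obtain ⟨u, hu_cont, hu⟩ := exists_continuous_indicatorConstLp_Ioc (weightMeasure_ac w)
  let T (t : ℝ≥0) : Hw w →L[ℝ] Hw w :=
    ((WithLp.prodContinuousLinearEquiv 2 ℝ ℝ (L2w w)).symm : ℝ × L2w w →L[ℝ] Hw w).comp
      ((WithLp.fstL 2 ℝ ℝ (L2w w)).prod
        ((WithLp.fstL 2 ℝ ℝ (L2w w)).smulRight (u t) + (S t).comp (WithLp.sndL 2 ℝ ℝ (L2w w))))
  refine ⟨T, isShiftFamily_iff.2 fun t x ↦ ⟨rfl, ?_⟩, fun x ↦ ?_⟩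
  · change (x.fst • u t + S t x.snd : L2w w) =ᵐ[weightMeasure w] _
    filter_upwards [Lp.coeFn_add (x.fst • u t) (S t x.snd), Lp.coeFn_smul x.fst (u t),
      hu t, hS t x.snd] with ξ hadd hsmul huξ hSξ
    rw [hadd, Pi.add_apply, hsmul, Pi.smul_apply, huξ, hSξ, profile_eq_indicator_add, add_comm]
    simp [indicator]
  · have hS_cont := hw.continuous_leftShift (by fun_prop) hSK hS x.snd
    exact (WithLp.prod_continuous_toLp 2 ℝ (L2w w)).comp
      (continuous_const.prodMk ((hu_cont.const_smul x.fst).add hS_cont))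

theorem ae_eq_of_forall_intervalIntegral_eq {E : Type*} [NormedAddCommGroup E] [NormedSpace ℝ E]
    [CompleteSpace E] {f g : ℝ → E} (hf : LocallyIntegrable f) (hg : LocallyIntegrable g)
    (h : ∀ a, ∫ η in (0 : ℝ)..a, f η = ∫ η in (0 : ℝ)..a, g η) : f =ᵐ[volume] g := by
  filter_upwards [LocallyIntegrable.ae_hasDerivAt_integral hf,
    LocallyIntegrable.ae_hasDerivAt_integral hg] with a hfa hga
  have hg' := hga 0
  simp only [← h] at hg'
  exact (hfa 0).unique hg'

theorem exists_pos_of_ae {p : ℝ → Prop} (h : ∀ᵐ η, p η) : ∃ η, 0 < η ∧ p η := by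
  have : (ae (volume.restrict (Ioi (0 : ℝ)))).NeBot := ae_restrict_neBot.2 (by simp)
  obtain ⟨η, hη, hη0⟩ :=
    ((ae_restrict_of_ae h).and (ae_restrict_mem (measurableSet_Ioi (a := (0 : ℝ))))).exists
  exact ⟨η, hη0, hη⟩

theorem IsWeight.locallyIntegrable_profile (hw : IsWeight w) (x : Hw w) :
    LocallyIntegrable (profile x) := by
  rw [profile_eq_indicator_add]
  exact (hw.memL2loc (Lp.memLp _)).locallyIntegrable.add
    ((locallyIntegrable_const _).indicator measurableSet_Ioi)

theorem IsWeight.intervalIntegrable_profile (hw : IsWeight w) (x : Hw w) (a b : ℝ) :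
    IntervalIntegrable (profile x) volume a b :=
  ((hw.locallyIntegrable_profile x).integrableOn_isCompact isCompact_uIcc).intervalIntegrable

theorem ext_of_profile_ae_eq {x y : Hw w} (h : profile x =ᵐ[volume] profile y) : x = y := by
  have hfst : x.fst = y.fst := by
    obtain ⟨η, hη0, hη⟩ := exists_pos_of_ae h
    rwa [profile_of_pos x hη0, profile_of_pos y hη0] at hη
  have hsnd : x.snd = y.snd := by
    refine Lp.ext ?_
    filter_upwards [(weightMeasure_ac_volume w).ae_le h, ae_le_zero_weightMeasure w] with η hη hη0
    rwa [profile_of_nonpos x hη0, profile_of_nonpos y hη0] at hη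
  exact WithLp.ofLp_injective 2 (Prod.ext hfst hsnd)

theorem IsWeight.ext_of_integral_profile_eq (hw : IsWeight w) {x y : Hw w}
    (h : ∀ a, ∫ η in (0 : ℝ)..a, profile x η = ∫ η in (0 : ℝ)..a, profile y η) : x = y :=
  ext_of_profile_ae_eq <| ae_eq_of_forall_intervalIntegral_eq (hw.locallyIntegrable_profile x)
    (hw.locallyIntegrable_profile y) h

theorem IsShiftFamily.profile_ae_eq (hw : IsWeight w) {T : ℝ≥0 → Hw w →L[ℝ] Hw w}
    (hT : IsShiftFamily w T) (t : ℝ≥0) (x : Hw w) :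
    profile (T t x) =ᵐ[volume] fun η ↦ profile x (t + η) := by
  obtain ⟨hfst, hsnd⟩ := isShiftFamily_iff.1 hT t x
  filter_upwards [(ae_restrict_iff' measurableSet_Iic).1 (hw.ae_eq hsnd)] with η hη
  rcases le_or_gt η 0 with hη0 | hη0
  · rw [profile_of_nonpos _ hη0, hη hη0]
  · rw [profile_of_pos _ hη0, profile_of_pos x (by positivity), hfst]

theorem IsShiftFamily.isC0Semigroup (hw : IsWeight w) {T : ℝ≥0 → Hw w →L[ℝ] Hw w}
    (hT : IsShiftFamily w T) (hcont : ∀ x, Continuous fun t ↦ T t x) : IsC0Semigroup T where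
  map_zero := by
    ext1 x
    refine ext_of_profile_ae_eq ((hT.profile_ae_eq hw 0 x).trans (.of_forall fun η ↦ ?_))
    simp
  map_add s t := by
    ext1 x
    refine ext_of_profile_ae_eq ?_
    calc profile (T (s + t) x)
        =ᵐ[volume] fun η ↦ profile x (t + (s + η)) :=
          (hT.profile_ae_eq hw (s + t) x).trans <| .of_forall fun η ↦ by
            simp only [NNReal.coe_add, add_comm (s : ℝ) t, add_assoc]
      _ =ᵐ[volume] fun η ↦ profile (T t x) (s + η) :=
          (ae_eq_comp_const_add (hT.profile_ae_eq hw t x) s).symm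
      _ =ᵐ[volume] profile (T s (T t x)) := (hT.profile_ae_eq hw s (T t x)).symm
  continuous_orbit := hcont

theorem integral_profile_of_nonneg (x : Hw w) {a : ℝ} (ha : 0 ≤ a) :
    ∫ η in (0 : ℝ)..a, profile x η = a * x.fst := by
  rw [intervalIntegral.integral_congr_Ioo_of_le ha (g := fun _ ↦ x.fst)
    fun η hη ↦ profile_of_pos x hη.1, intervalIntegral.integral_const, sub_zero, smul_eq_mul]

theorem integral_profile_of_nonpos (x : Hw w) {a : ℝ} (ha : a ≤ 0) :
    ∫ η in (0 : ℝ)..a, profile x η = -∫ η in Icc a 0, x.snd η := by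
  rw [intervalIntegral.integral_of_ge ha, ← integral_Icc_eq_integral_Ioc]
  exact congrArg _ (setIntegral_congr_fun measurableSet_Icc fun η hη ↦ profile_of_nonpos x hη.2)

theorem IsWeight.exists_setIntegral_IccL (hw : IsWeight w) (a : ℝ) :
    ∃ ℓ : L2w w →L[ℝ] ℝ, ∀ f, ℓ f = ∫ ξ in Icc a 0, f ξ := by
  obtain ⟨c, hc, h⟩ := hw.exists_restrict_Icc_le a
  refine ⟨(innerSL ℝ (indicatorConstLp 2 MeasurableSet.univ (measure_ne_top _ _) (1 : ℝ))).comp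
    (Lp.LpToLpOfMeasureLeSMul hc h), fun f ↦ ?_⟩
  rw [ContinuousLinearMap.comp_apply, innerSL_apply_apply, L2.inner_indicatorConstLp_one,
    setIntegral_univ]
  exact integral_congr_ae (Lp.coeFn_LpToLpOfMeasureLeSMul hc h f)

theorem IsWeight.exists_integral_profileL (hw : IsWeight w) (a : ℝ) :
    ∃ ℓ : Hw w →L[ℝ] ℝ, ∀ x, ℓ x = ∫ η in (0 : ℝ)..a, profile x η := by
  rcases le_total a 0 with ha | ha
  · obtain ⟨ℓ, hℓ⟩ := hw.exists_setIntegral_IccL a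
    refine ⟨-ℓ.comp (WithLp.sndL 2 ℝ ℝ (L2w w)), fun x ↦ ?_⟩
    rw [integral_profile_of_nonpos x ha, ← hℓ]
    rfl
  · exact ⟨a • WithLp.fstL 2 ℝ ℝ (L2w w), fun x ↦ (integral_profile_of_nonneg x ha).symm⟩

theorem IsShiftFamily.integral_profile (hw : IsWeight w) {T : ℝ≥0 → Hw w →L[ℝ] Hw w}
    (hT : IsShiftFamily w T) (t : ℝ≥0) (x : Hw w) (a : ℝ) :
    ∫ η in (0 : ℝ)..a, profile (T t x) η =
      (∫ η in (0 : ℝ)..a + t, profile x η) - ∫ η in (0 : ℝ)..t, profile x η := by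
  rw [intervalIntegral.integral_congr_ae ((hT.profile_ae_eq hw t x).mono fun η hη _ ↦ hη),
    intervalIntegral.integral_comp_add_left (profile x), add_zero, add_comm (t : ℝ),
    intervalIntegral.integral_interval_sub_left (hw.intervalIntegrable_profile ..)
      (hw.intervalIntegrable_profile ..)]

theorem IsShiftFamily.integral_profile_sub (hw : IsWeight w) {T : ℝ≥0 → Hw w →L[ℝ] Hw w}
    (hT : IsShiftFamily w T) (t : ℝ≥0) (x : Hw w) (a : ℝ) :
    ∫ η in (0 : ℝ)..a, profile (T t x - x) η =
      (∫ s in (0 : ℝ)..t, profile x (a + s)) - ∫ s in (0 : ℝ)..t, profile x s := by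
  obtain ⟨ℓ, hℓ⟩ := hw.exists_integral_profileL a
  rw [← hℓ, map_sub, hℓ, hℓ, hT.integral_profile hw, sub_right_comm,
    intervalIntegral.integral_comp_add_left (profile x), add_zero,
    intervalIntegral.integral_interval_sub_left (hw.intervalIntegrable_profile ..)
      (hw.intervalIntegrable_profile ..)]

end Profile

section WeakDerivative

theorem integrable_smul_of_tsupport_subset {X E : Type*} [TopologicalSpace X] [T2Space X]
    [MeasurableSpace X] [OpensMeasurableSpace X] [NormedAddCommGroup E] [NormedSpace ℝ E]
    {μ : Measure X} {U : Set X} {f : X → E} {φ : X → ℝ} (hf : LocallyIntegrableOn f U μ)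
    (hφ : Continuous φ) (hφc : HasCompactSupport φ) (hφU : tsupport φ ⊆ U) :
    Integrable (fun x ↦ φ x • f x) μ := by
  have hK : IntegrableOn (fun x ↦ φ x • f x) (tsupport φ) μ :=
    (hf.integrableOn_compact_subset hφU hφc).continuousOn_smul hφ.continuousOn hφc
  exact (integrableOn_iff_integrable_of_support_subset
    ((Function.support_smul_subset_left φ f).trans (subset_tsupport φ))).1 hK

theorem ae_eq_of_setIntegral_contDiff_smul_eq {X E : Type*} [NormedAddCommGroup X]
    [NormedSpace ℝ X] [FiniteDimensional ℝ X] [MeasurableSpace X] [BorelSpace X]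
    [NormedAddCommGroup E] [NormedSpace ℝ E] [CompleteSpace E] {μ : Measure X} {U : Set X}
    (hU : IsOpen U) {f g : X → E} (hf : LocallyIntegrableOn f U μ)
    (hg : LocallyIntegrableOn g U μ)
    (h : ∀ φ : X → ℝ, ContDiff ℝ 1 φ → HasCompactSupport φ → tsupport φ ⊆ U →
      ∫ x in U, φ x • f x ∂μ = ∫ x in U, φ x • g x ∂μ) :
    f =ᵐ[μ.restrict U] g := by
  refine (ae_restrict_iff' hU.measurableSet).2 <|
    (hU.ae_eq_zero_of_integral_contDiff_smul_eq_zero (hf.sub hg) fun φ hφ hφc hφU ↦ ?_).mono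
      fun x hx hxU ↦ sub_eq_zero.1 (hx hxU)
  have hzero : ∀ x ∉ U, φ x • (f - g) x = 0 := fun x hx ↦ by
    rw [image_eq_zero_of_notMem_tsupport fun hx' ↦ hx (hφU hx'), zero_smul]
  rw [← setIntegral_eq_integral_of_forall_compl_eq_zero hzero]
  simp only [Pi.sub_apply, smul_sub]
  rw [integral_sub (integrable_smul_of_tsupport_subset hf hφ.continuous hφc hφU).integrableOn
    (integrable_smul_of_tsupport_subset hg hφ.continuous hφc hφU).integrableOn,
    h φ (hφ.of_le (by norm_cast)) hφc hφU, sub_self]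

theorem locallyIntegrableOn_Iio_of_integrableOn_Icc {E : Type*} [NormedAddCommGroup E]
    {f : ℝ → E} {b : ℝ} (h : ∀ a < b, IntegrableOn f (Icc a b)) :
    LocallyIntegrableOn f (Iio b) := fun x hx ↦
  ⟨Icc (x - 1) b, mem_nhdsWithin_of_mem_nhds (Icc_mem_nhds (sub_one_lt x) hx),
    h _ ((sub_one_lt x).trans hx)⟩

theorem setIntegral_Iic_eq_intervalIntegral {E : Type*} [NormedAddCommGroup E] [NormedSpace ℝ E]
    {f : ℝ → E} {a b : ℝ} (hab : a ≤ b) (h : ∀ ξ ≤ a, f ξ = 0) :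
    ∫ ξ in Iic b, f ξ = ∫ ξ in a..b, f ξ := by
  rw [intervalIntegral.integral_of_le hab]
  exact setIntegral_eq_of_subset_of_forall_sdiff_eq_zero measurableSet_Iic Ioc_subset_Iic_self
    fun ξ hξ ↦ h ξ (not_lt.1 fun hlt ↦ hξ.2 ⟨hlt, hξ.1⟩)

theorem setIntegral_Iic_mul_deriv_eq_neg {F φ : ℝ → ℝ} {b : ℝ}
    (hF : ∀ a ≤ b, AbsolutelyContinuousOnInterval F a b) (hφ : ContDiff ℝ 1 φ)
    (hφc : HasCompactSupport φ) (hφb : tsupport φ ⊆ Iio b) :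
    ∫ ξ in Iic b, F ξ * deriv φ ξ = -∫ ξ in Iic b, deriv F ξ * φ ξ := by
  obtain ⟨c, hc⟩ := hφc.isCompact.bddBelow
  have hab : min c b - 1 ≤ b := by linarith [min_le_right c b]
  have hsupp : ∀ ξ ≤ min c b - 1, ξ ∉ tsupport φ := fun ξ hξ h ↦ by
    linarith [min_le_left c b, hc h]
  have hφ0 : ∀ ξ ≤ min c b - 1, φ ξ = 0 := fun ξ hξ ↦
    image_eq_zero_of_notMem_tsupport (hsupp ξ hξ)
  have hφ'0 : ∀ ξ ≤ min c b - 1, deriv φ ξ = 0 := fun ξ hξ ↦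
    image_eq_zero_of_notMem_tsupport fun h ↦ hsupp ξ hξ (tsupport_deriv_subset h)
  have hφb0 : φ b = 0 := image_eq_zero_of_notMem_tsupport fun h ↦ lt_irrefl b (hφb h)
  rw [setIntegral_Iic_eq_intervalIntegral hab fun ξ hξ ↦ by rw [hφ'0 ξ hξ, mul_zero],
    setIntegral_Iic_eq_intervalIntegral hab fun ξ hξ ↦ by rw [hφ0 ξ hξ, mul_zero],
    (hF _ hab).integral_mul_deriv_eq_deriv_mul hφ.contDiffOn.absolutelyContinuousOnInterval,
    hφb0, hφ0 _ le_rfl, mul_zero, mul_zero, sub_zero, zero_sub]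

theorem hasWeakDeriv_iff_deriv_ae_eq {f g F : ℝ → ℝ} (hf : MemL2loc f) (hg : MemL2loc g)
    (hF : ∀ a ≤ 0, AbsolutelyContinuousOnInterval F a 0)
    (hfF : f =ᵐ[volume.restrict (Iic 0)] F) :
    HasWeakDeriv f g ↔ deriv F =ᵐ[volume.restrict (Iic 0)] g := by
  have hparts (φ : ℝ → ℝ) (hφ : ContDiff ℝ 1 φ) (hφc : HasCompactSupport φ)
      (hφ0 : tsupport φ ⊆ Iio 0) :
      ∫ ξ in Iic 0, f ξ * deriv φ ξ = -∫ ξ in Iic 0, deriv F ξ * φ ξ := by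
    rw [← setIntegral_Iic_mul_deriv_eq_neg hF hφ hφc hφ0]
    exact integral_congr_ae (hfF.mul (ae_eq_refl (deriv φ)))
  refine ⟨fun h ↦ ?_, fun h ↦ ⟨hf, hg, fun φ hφ hφc hφ0 ↦ ?_⟩⟩
  · rw [← restrict_Iio_eq_restrict_Iic]
    refine ae_eq_of_setIntegral_contDiff_smul_eq isOpen_Iio
      (locallyIntegrableOn_Iio_of_integrableOn_Icc fun a ha ↦ ?_)
      (locallyIntegrableOn_Iio_of_integrableOn_Icc fun a _ ↦ (hg a).integrable one_le_two)
      fun φ hφ hφc hφ0 ↦ ?_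
    · exact (intervalIntegrable_iff_integrableOn_Icc_of_le ha.le).1
        (hF a ha.le).intervalIntegrable_deriv
    · simpa only [restrict_Iio_eq_restrict_Iic, smul_eq_mul, mul_comm (φ _)] using
        neg_injective ((hparts φ hφ hφc hφ0).symm.trans (h.integral_eq φ hφ hφc hφ0))
  · rw [hparts φ hφ hφc hφ0]
    exact congrArg _ (integral_congr_ae (h.mul (ae_eq_refl φ)))

theorem hasValueAtZero_and_hasWeakDeriv_iff {f g : ℝ → ℝ} {c : ℝ} (hf : MemL2loc f)
    (hg : MemL2loc g) (hg' : LocallyIntegrable g) :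
    HasValueAtZero f c ∧ HasWeakDeriv f g ↔
      f =ᵐ[volume.restrict (Iic 0)] fun a ↦ c + ∫ η in (0 : ℝ)..a, g η := by
  constructor
  · rintro ⟨⟨F, hF, hfF, rfl⟩, h⟩
    have hderiv := (hasWeakDeriv_iff_deriv_ae_eq hf hg hF hfF).1 h
    filter_upwards [hfF, ae_restrict_mem measurableSet_Iic] with a hfa ha
    have hint : ∫ η in a..0, g η = F 0 - F a := by
      rw [← (hF a ha).integral_deriv_eq_sub, intervalIntegral.integral_of_le ha,
        intervalIntegral.integral_of_le ha]
      exact integral_congr_ae <|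
        ae_restrict_of_ae_restrict_of_subset Ioc_subset_Iic_self hderiv.symm
    rw [hfa, intervalIntegral.integral_symm, hint]
    ring
  · intro h
    have hF : ∀ a ≤ 0, AbsolutelyContinuousOnInterval (fun a ↦ c + ∫ η in (0 : ℝ)..a, g η) a 0 :=
      fun a _ ↦ (LipschitzWith.const c).lipschitzOnWith.absolutelyContinuousOnInterval.add
        ((hg'.integrableOn_isCompact isCompact_uIcc).intervalIntegrable
          |>.absolutelyContinuousOnInterval_intervalIntegral (by simp))
    refine ⟨⟨_, hF, h, by simp⟩, (hasWeakDeriv_iff_deriv_ae_eq hf hg hF h).2 ?_⟩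
    filter_upwards [ae_restrict_of_ae (LocallyIntegrable.ae_hasDerivAt_integral hg')] with a ha
    exact ((ha 0).const_add c).deriv

variable {w : ℝ → ℝ}

theorem mem_graph_opA_iff (hw : IsWeight w) {x y : Hw w} : (x, y) ∈ (opA w hw).graph ↔
    y.fst = 0 ∧ HasValueAtZero x.snd x.fst ∧ HasWeakDeriv x.snd y.snd := by
  rw [LinearPMap.mem_graph_iff]
  constructor
  · rintro ⟨x, rfl, rfl⟩
    exact ⟨rfl, x.2.2, weakDeriv_spec x⟩
  · rintro ⟨hy, hval, hderiv⟩
    refine ⟨⟨x, ⟨Lp.memLp _, _, hderiv, Lp.memLp _⟩, hval⟩, rfl, ?_⟩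
    exact WithLp.ofLp_injective 2 (Prod.ext hy.symm (weakDeriv_eq _ _ hderiv))

theorem mem_graph_opA_iff_profile (hw : IsWeight w) {x y : Hw w} :
    (x, y) ∈ (opA w hw).graph ↔
      profile x =ᵐ[volume] fun a ↦ x.fst + ∫ η in (0 : ℝ)..a, profile y η := by
  have hL2 (z : Hw w) : MemL2loc z.snd := hw.memL2loc (Lp.memLp _)
  have hprofile (z : Hw w) : z.snd =ᵐ[volume.restrict (Iic 0)] profile z :=
    (ae_restrict_mem measurableSet_Iic).mono fun η hη ↦ (profile_of_nonpos z hη).symm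
  have hiff := hasValueAtZero_and_hasWeakDeriv_iff (c := x.fst) (hL2 x)
    ((hL2 y).congr (hprofile y)) (hw.locallyIntegrable_profile y)
  rw [mem_graph_opA_iff]
  constructor
  · rintro ⟨hy, hval, hderiv⟩
    have hIic := (hprofile x).symm.trans
      (hiff.1 ⟨hval, hderiv.congr (ae_eq_refl _) (hprofile y)⟩)
    filter_upwards [(ae_restrict_iff' measurableSet_Iic).1 hIic] with a ha
    rcases le_or_gt a 0 with ha0 | ha0
    · exact ha ha0
    · rw [integral_profile_of_nonneg y ha0.le, hy, mul_zero, add_zero, profile_of_pos x ha0]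
  · intro h
    obtain ⟨a, ha0, ha⟩ := exists_pos_of_ae h
    have hy : y.fst = 0 := by
      simpa [integral_profile_of_nonneg y ha0.le, profile_of_pos x ha0, ha0.ne'] using ha
    obtain ⟨hval, hderiv⟩ := hiff.2 ((hprofile x).trans (ae_restrict_of_ae h))
    exact ⟨hy, hval, hderiv.congr (ae_eq_refl _) (hprofile y).symm⟩

end WeakDerivative

section Generator

variable {w : ℝ → ℝ} {T : ℝ≥0 → Hw w →L[ℝ] Hw w} {x y : Hw w}

theorem IsShiftFamily.sub_eq_integral_of_profile (hw : IsWeight w) (hT : IsShiftFamily w T)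
    (hC : IsC0Semigroup T)
    (h : profile x =ᵐ[volume] fun a ↦ x.fst + ∫ η in (0 : ℝ)..a, profile y η) (t : ℝ≥0) :
    T t x - x = ∫ s in (0 : ℝ)..t, T s.toNNReal y := by
  refine hw.ext_of_integral_profile_eq fun a ↦ ?_
  obtain ⟨ℓ, hℓ⟩ := hw.exists_integral_profileL a
  calc ∫ η in (0 : ℝ)..a, profile (T t x - x) η
      = ∫ s in (0 : ℝ)..t, (profile x (a + s) - profile x s) := by
        rw [hT.integral_profile_sub hw, intervalIntegral.integral_sub ?_
          (hw.intervalIntegrable_profile ..)]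
        simpa using (hw.intervalIntegrable_profile x a (a + t)).comp_add_left a
    _ = ∫ s in (0 : ℝ)..t, ℓ (T s.toNNReal y) := by
        refine intervalIntegral.integral_congr_ae ?_
        filter_upwards [h, ae_eq_comp_const_add h a] with s hs has hst
        rw [uIoc_of_le t.coe_nonneg] at hst
        rw [hs, has, hℓ, hT.integral_profile hw, Real.coe_toNNReal _ hst.1.le]
        ring
    _ = ∫ η in (0 : ℝ)..a, profile (∫ s in (0 : ℝ)..t, T s.toNNReal y) η := by
        rw [ℓ.intervalIntegral_comp_comm (hC.intervalIntegrable ..), hℓ]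

theorem IsShiftFamily.profile_ae_eq_of_tendsto (hw : IsWeight w) (hT : IsShiftFamily w T)
    (h : Tendsto (fun t : ℝ≥0 ↦ (t : ℝ)⁻¹ • (T t x - x)) (𝓝[>] 0) (𝓝 y)) :
    profile x =ᵐ[volume] fun a ↦ x.fst + ∫ η in (0 : ℝ)..a, profile y η := by
  filter_upwards [LocallyIntegrable.ae_hasDerivAt_integral (hw.locallyIntegrable_profile x)]
    with a ha
  obtain ⟨ℓ, hℓ⟩ := hw.exists_integral_profileL a
  have hslope : Tendsto (fun t : ℝ≥0 ↦ (t : ℝ)⁻¹ * ∫ s in (0 : ℝ)..t, profile x (a + s))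
      (𝓝[>] 0) (𝓝 (profile x a)) := by
    simpa using! (ha a).tendsto_slope_zero_right.comp tendsto_coe_nhdsGT_zero
  have hℓlim : Tendsto (fun t : ℝ≥0 ↦ ℓ ((t : ℝ)⁻¹ • (T t x - x))) (𝓝[>] 0)
      (𝓝 (profile x a - x.fst)) := by
    refine (hslope.sub_const x.fst).congr' ?_
    filter_upwards [self_mem_nhdsWithin] with t ht
    have ht0 : (t : ℝ) ≠ 0 := by exact_mod_cast (mem_Ioi.1 ht).ne'
    rw [map_smul, hℓ, hT.integral_profile_sub hw, integral_profile_of_nonneg x t.coe_nonneg,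
      smul_eq_mul, mul_sub, inv_mul_cancel_left₀ ht0]
  rw [← hℓ, ← tendsto_nhds_unique hℓlim ((ℓ.continuous.tendsto y).comp h), add_sub_cancel]

theorem IsShiftFamily.isGenerator_opA (hw : IsWeight w) (hT : IsShiftFamily w T)
    (hC : IsC0Semigroup T) : IsGenerator T (opA w hw) :=
  isGenerator_iff_mem_graph.2 fun _ _ ↦ (mem_graph_opA_iff_profile hw).trans
    ⟨fun h ↦ hC.tendsto_iff_eq_integral.2 (hT.sub_eq_integral_of_profile hw hC h),
      hT.profile_ae_eq_of_tendsto hw⟩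

theorem opA_domain_ne_top (hw : IsWeight w) : (opA w hw).domain ≠ ⊤ := by
  intro h
  let x : Hw w := WithLp.toLp 2 (1, 0)
  obtain ⟨F, hF, hxF, hF0⟩ : HasValueAtZero x.snd x.fst :=
    (h ▸ Submodule.mem_top : x ∈ (opA w hw).domain).2
  have hzero : F =ᵐ[volume.restrict (Icc (-1) 0)] fun _ ↦ (0 : ℝ) :=
    ae_restrict_of_ae_restrict_of_subset Icc_subset_Iic_self
      (hxF.symm.trans (hw.ae_eq (Lp.coeFn_zero _ _ _)))
  have hcont : ContinuousOn F (Icc (-1) 0) := by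
    simpa [uIcc_of_le] using (hF (-1) (by simp)).continuousOn
  have h0 : F 0 = 0 := Measure.eqOn_Icc_of_ae_eq volume (by simp) hzero hcont continuousOn_const
    (by simp)
  exact one_ne_zero (hF0.symm.trans h0)

end Generator

end DelayShift

theorem mainTheorem7 (w : ℝ → ℝ) (hw : DelayShift.IsWeight w) :
    ∃ T : ℝ≥0 → DelayShift.Hw w →L[ℝ] DelayShift.Hw w,
      DelayShift.IsShiftFamily w T ∧
      DelayShift.IsC0Semigroup T ∧
      DelayShift.IsGenerator T (DelayShift.opA w hw) ∧
      (DelayShift.opA w hw).IsClosed ∧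
      ¬ ∃ C : ℝ, ∀ x : (DelayShift.opA w hw).domain,
        ‖DelayShift.opA w hw x‖ ≤ C * ‖(x : DelayShift.Hw w)‖ := by
  obtain ⟨T, hT, hcont⟩ := hw.exists_isShiftFamily
  have hC : DelayShift.IsC0Semigroup T := hT.isC0Semigroup hw hcont
  have hA : DelayShift.IsGenerator T (DelayShift.opA w hw) := hT.isGenerator_opA hw hC
  exact ⟨T, hT, hC, hA, hA.isClosed hC, hA.not_bounded hC (DelayShift.opA_domain_ne_top hw)⟩
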